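/- Let $r \geq 1$ and $m \geq 0$ be integers and let $\mathbf n = (n_1,\dots,n_r)$ be positive integers. Put $V(\mathbf n) = \mathbb{C}^{n_1}\otimes\cdots\otimes\mathbb{C}^{n_r}$ and $G(\mathbf n) = \mathrm{GL}(n_1)\times\cdots\times \mathrm{GL}(n_r)$, acting on $V(\mathbf n)$ by $(g_1,\dots,g_r)\cdot(v_1\otimes\cdots\otimes v_r) = g_1v_1\otimes\cdots\otimes g_rv_r$, on $V(\mathbf n)^*$ by the dual action, and on the symmetric algebra $\mathcal S(V(\mathbf n)\oplus V(\mathbf n)^*)$ by the induced algebra automorphisms. For a multi-index $I=(i_1,\dots,i_r)$ with $1\le i_k\le n_k$, let $x^{I}$ be the element $e^{i_1}\otimes\cdots\otimes e^{i_r}$ of $V(\mathbf n)^*$ and $y_{I}$ the element $e_{i_1}\otimes\cdots\otimes e_{i_r}$ of $V(\mathbf n)$ (standard bases), both regarded as degree one elements of $\mathcal S(V(\mathbf n)\oplus V(\mathbf n)^*)$; under the natural identification of $\mathcal S(V(\mathbf n)\oplus V(\mathbf n)^*)$ with the polynomial functions on $V(\mathbf n)\oplus V(\mathbf n)^*$ they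 are the coordinate functions of $(X,Y)$, $X=\sum x^I e_{i_1}\otimes\cdots\otimes e_{i_r}$, $Y=\sum y_I e^{i_1}\otimes\cdots\otimes e^{i_r}$. Let $S_m$ be the symmetric group on $\{1,\dots,m\}$. For $\mathbf s=(\sigma_1,\dots,\sigma_{r-1})\in S_m^{r-1}$ put $\sigma_r=1$ and \[ f_{\mathbf s} = \sum \ \prod_{j=1}^m x^{i^{(j)}_1\cdots i^{(j)}_r}\; y_{i^{(\sigma_1(j))}_1\cdots i^{(\sigma_r(j))}_r}, \] the sum being over all choices of indices $1\le i^{(j)}_k\le n_k$ ($1\le j\le m$, $1\le k\le r$). Let $S_m$ act on $S_m^{r-1}$ by simultaneous conjugation, $\gamma\cdot(\sigma_1,\dots,\sigma_{r-1}) = (\gamma\sigma_1\gamma^{-1},\dots,\gamma\sigma_{r-1}\gamma^{-1})$, let $t = |S_m^{r-1}/S_m|$ be the number of orbits, and choose one representative $\mathbf s_1,\dots,\mathbf s_t$ from each orbit. Then $f_{\mathbf s_1},\dots,f_{\mathbf s_t}$ span the space $\mathcal S^{2m}(V(\mathbf n)\oplus V(\mathbf n)^*)^{G(\mathbf n)}$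 of $G(\mathbf n)$-invariants of degree $2m$. If moreover $n_k\ge m$ for all $1\le k\le r$, then $f_{\mathbf s_1},\dots,f_{\mathbf s_t}$ form a basis of this space. -/

import Mathlib

open scoped TensorProduct

noncomputable section

namespace TensorInvariants

/-! ### The symmetric algebra of a representation -/

/-- The degree `d` component `S^d(M)` of the symmetric algebra: the span of all products
`x₁ ⋯ x_d` with `x₁, …, x_d ∈ M`. -/
def symPower (M : Type*) [AddCommGroup M] [Module ℂ M] (d : ℕ) :
    Submodule ℂ (SymmetricAlgebra ℂ M) :=
  LinearMap.range (SymmetricAlgebra.ι ℂ M) ^ d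

/-- The action of `G` on `S(M)` by algebra automorphisms that extends a representation on `M`. -/
def symRep {G : Type*} [Group G] {M : Type*} [AddCommGroup M] [Module ℂ M]
    (ρ : Representation ℂ G M) : Representation ℂ G (SymmetricAlgebra ℂ M) where
  toFun g := (SymmetricAlgebra.lift (SymmetricAlgebra.ι ℂ M ∘ₗ ρ g)).toLinearMap
  map_one' := by
    have h : SymmetricAlgebra.lift (SymmetricAlgebra.ι ℂ M ∘ₗ ρ 1)
        = AlgHom.id ℂ (SymmetricAlgebra ℂ M) := by
      ext x; simp
    rw [h]; rfl
  map_mul' g h := by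
    have e : SymmetricAlgebra.lift (SymmetricAlgebra.ι ℂ M ∘ₗ ρ (g * h))
        = (SymmetricAlgebra.lift (SymmetricAlgebra.ι ℂ M ∘ₗ ρ g)).comp
          (SymmetricAlgebra.lift (SymmetricAlgebra.ι ℂ M ∘ₗ ρ h)) := by
      ext x; simp
    rw [e]; rfl

/-! ### The space `V(n)`, the group `G(n)` and its representations -/

variable {r : ℕ}

/-- `V(n) = ℂ^{n₁} ⊗ ⋯ ⊗ ℂ^{n_r}`. -/
abbrev V (n : Fin r → ℕ) : Type := ⨂[ℂ] k, (Fin (n k) → ℂ)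

/-- `V(n) ⊕ V(n)^*`. -/
abbrev W (n : Fin r → ℕ) : Type := V n × Module.Dual ℂ (V n)

/-- `G(n) = GL(n₁) × ⋯ × GL(n_r)`. -/
abbrev G (n : Fin r → ℕ) : Type := (k : Fin r) → GL (Fin (n k)) ℂ

/-- The outer action `(g₁, …, g_r) • (v₁ ⊗ ⋯ ⊗ v_r) = g₁ v₁ ⊗ ⋯ ⊗ g_r v_r` of `G(n)` on `V(n)`. -/
def repV (n : Fin r → ℕ) : Representation ℂ (G n) (V n) where
  toFun g := PiTensorProduct.map fun k => (g k : Matrix (Fin (n k)) (Fin (n k)) ℂ).mulVecLin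
  map_one' := by
    simp only [Pi.one_apply, Units.val_one, Matrix.mulVecLin_one]
    exact PiTensorProduct.map_one
  map_mul' g h := by
    simp only [Pi.mul_apply, Units.val_mul, Matrix.mulVecLin_mul]
    exact PiTensorProduct.map_comp _ _

/-- The representation of `G(n)` on `V(n) ⊕ V(n)^*`, with the dual action on `V(n)^*`. -/
def repW (n : Fin r → ℕ) : Representation ℂ (G n) (W n) :=
  (repV n).prod (repV n).dual

/-- The space `S^d(V(n) ⊕ V(n)^*)^{G(n)}` of invariants. -/
def invariants (n : Fin r → ℕ) (d : ℕ) : Submodule ℂ (SymmetricAlgebra ℂ (W n)) :=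
  symPower (W n) d ⊓ (symRep (repW n)).invariants

/-! ### Coordinates -/

/-- Multi-indices `(i₁, …, i_r)` with `i_k` ranging over `n_k` values. -/
abbrev Idx (n : Fin r → ℕ) : Type := (k : Fin r) → Fin (n k)

/-- The basis tensor `e_{i₁} ⊗ ⋯ ⊗ e_{i_r}` of `V(n)`. -/
def e (n : Fin r → ℕ) (I : Idx n) : V n :=
  PiTensorProduct.tprod ℂ fun k => Pi.single (I k) (1 : ℂ)

/-- The tensor `e^{i₁} ⊗ ⋯ ⊗ e^{i_r}` of `V(n)^*`: its value on `v₁ ⊗ ⋯ ⊗ v_r` is the product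
of the `i_k`-th coordinates of the `v_k`. -/
def eDual (n : Fin r → ℕ) (I : Idx n) : Module.Dual ℂ (V n) :=
  PiTensorProduct.dualDistrib (PiTensorProduct.tprod ℂ fun k => LinearMap.proj (I k))

/-- The coordinate function `x^I` on `V(n) ⊕ V(n)^*`, as an element of `S(V(n) ⊕ V(n)^*)`. -/
def x (n : Fin r → ℕ) (I : Idx n) : SymmetricAlgebra ℂ (W n) :=
  SymmetricAlgebra.ι ℂ (W n) (0, eDual n I)

/-- The coordinate function `y_I` on `V(n) ⊕ V(n)^*`, as an element of `S(V(n) ⊕ V(n)^*)`. -/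
def y (n : Fin r → ℕ) (I : Idx n) : SymmetricAlgebra ℂ (W n) :=
  SymmetricAlgebra.ι ℂ (W n) (e n I, 0)

/-- For an `m`-tuple of multi-indices `I^{(1)}, …, I^{(m)}` and permutations `σ₁, …, σ_r` of
`{1, …, m}`, the multi-index `(i₁^{(σ₁(j))}, …, i_r^{(σ_r(j))})`. -/
def permIdx {n : Fin r → ℕ} {m : ℕ} (σ : Fin r → Equiv.Perm (Fin m)) (I : Fin m → Idx n)
    (j : Fin m) : Idx n :=
  fun k => I (σ k j) k

/-- The polynomial `∑_I ∏_j x^{i₁^{(j)} ⋯ i_r^{(j)}} y_{i₁^{(σ₁(j))} ⋯ i_r^{(σ_r(j))}}`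
attached to an `r`-tuple of permutations. -/
def fullPoly (n : Fin r → ℕ) {m : ℕ} (σ : Fin r → Equiv.Perm (Fin m)) :
    SymmetricAlgebra ℂ (W n) :=
  ∑ I : Fin m → Idx n, ∏ j : Fin m, (x n (I j) * y n (permIdx σ I j))

/-- The polynomial `f_s` of `s = (σ₁, …, σ_{r-1})`, in which `σ_r = 1`. The number of tensor
factors is `r = q + 1`. -/
def f {q : ℕ} (n : Fin (q + 1) → ℕ) {m : ℕ} (s : Fin q → Equiv.Perm (Fin m)) :
    SymmetricAlgebra ℂ (W n) :=
  fullPoly n (Fin.snoc (α := fun _ => Equiv.Perm (Fin m)) s 1)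

/-- The set `S_m^q / S_m` of orbits of `S_m` acting on `S_m^q` by simultaneous conjugation. -/
abbrev ConjOrbits (q m : ℕ) : Type :=
  MulAction.orbitRel.Quotient (ConjAct (Equiv.Perm (Fin m))) (Fin q → Equiv.Perm (Fin m))

/-! ### Elements of `S(V(n) ⊕ V(n)^*)` as polynomial functions on `V(n) ⊕ V(n)^*` -/

/-- The value at `(X, Y)` of an element of `S(V(n) ⊕ V(n)^*)`, where `V(n) ⊕ V(n)^*` is identified
with its own dual: `(v, φ)` is the linear function `(X, Y) ↦ Y(v) + φ(X)`. -/
def evalAt {n : Fin r → ℕ} (X : V n) (Y : Module.Dual ℂ (V n)) :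
    SymmetricAlgebra ℂ (W n) →ₐ[ℂ] ℂ :=
  SymmetricAlgebra.lift (Y.coprod (Module.Dual.eval ℂ (V n) X))

theorem evalAt_x {n : Fin r → ℕ} (a : Idx n → ℂ) (Y : Module.Dual ℂ (V n)) (I : Idx n) :
    evalAt (∑ J, a J • e n J) Y (x n I) = a I := by
  have h : ∀ J, eDual n I (e n J) = if I = J then 1 else 0 := by
    intro J
    simp only [eDual, e, PiTensorProduct.dualDistrib_apply, LinearMap.proj_apply, Pi.single_apply,
      Fintype.prod_ite_zero, Finset.prod_const_one, ← funext_iff]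
  simp [evalAt, x, h]

theorem evalAt_y {n : Fin r → ℕ} (X : V n) (b : Idx n → ℂ) (I : Idx n) :
    evalAt X (∑ J, b J • eDual n J) (y n I) = b I := by
  have h : ∀ J, eDual n J (e n I) = if J = I then 1 else 0 := by
    intro J
    simp only [eDual, e, PiTensorProduct.dualDistrib_apply, LinearMap.proj_apply, Pi.single_apply,
      Fintype.prod_ite_zero, Finset.prod_const_one, ← funext_iff]
  simp [evalAt, y, h]

/-- The value of `f_s` at `X = ∑ a^J e_J`, `Y = ∑ b_J e^J`. -/
theorem evalAt_f {q : ℕ} {n : Fin (q + 1) → ℕ} {m : ℕ} (s : Fin q → Equiv.Perm (Fin m))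
    (a b : Idx n → ℂ) :
    evalAt (∑ J, a J • e n J) (∑ J, b J • eDual n J) (f n s) =
      ∑ I : Fin m → Idx n, ∏ j : Fin m, (a (I j) *
        b (permIdx (Fin.snoc (α := fun _ => Equiv.Perm (Fin m)) s 1) I j)) := by
  simp only [f, fullPoly, map_sum, map_prod, map_mul, evalAt_x, evalAt_y]

/-- The orbits are those of `γ • (σ₁, …, σ_q) = (γ σ₁ γ⁻¹, …, γ σ_q γ⁻¹)`. -/
theorem conjOrbits_mk_eq_iff {q m : ℕ} (s t : Fin q → Equiv.Perm (Fin m)) :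
    (Quotient.mk'' s : ConjOrbits q m) = Quotient.mk'' t ↔
      ∃ γ : Equiv.Perm (Fin m), ∀ k, γ * t k * γ⁻¹ = s k := by
  rw [Quotient.eq'', MulAction.orbitRel_apply, MulAction.mem_orbit_iff]
  constructor
  · rintro ⟨g, rfl⟩
    exact ⟨ConjAct.ofConjAct g, fun k => by simp [ConjAct.smul_def]⟩
  · rintro ⟨γ, h⟩
    exact ⟨ConjAct.toConjAct γ, funext fun k => by simp [ConjAct.smul_def, h]⟩

end TensorInvariants

end

/-!
Put `K g = g₁^{⊗m} ⊗ ⋯ ⊗ g_r^{⊗m}`, acting on `V(n)^{⊗m}`, and let `S_m^r` act on the same space by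
permuting the `m` places separately in each of the `r` tensor factors. A matrix `M` on `V(n)^{⊗m}`
is an element of `V(n)^{⊗m} ⊗ (V(n)^*)^{⊗m}`; its image in `S(V(n) ⊕ V(n)^*)` is
`restitution n m M = ∑ M_{BA} y^B x^A`, and `g` carries the image of `M` to the image of
`K g * M * (K g)⁻¹` (`symRep_restitution`).

*Spanning.* The group element that multiplies `V(n)` by `2` multiplies a monomial of degree `a` in
`y` and `b` in `x` by `2^{a-b}`, so an invariant of degree `2m` has degree `m` in each set of
variables and is the image of a matrix (`mem_range_restitution`). Averaging over `S_m × S_m`, the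
matrix may be taken invariant under permutations of the row tuple and of the column tuple;
on such matrices the restitution is injective, so the matrix of an invariant commutes with every
`K g`. It is then a combination of place permutations of `S_m^r` (`mem_span_range_placeMatrix`), whose images are the polynomials
`fullPoly n σ`. Multiplying `σ` on either side by a diagonal element of `S_m^r` only reorders the
factors of each product and renames the indices of summation; this allows `σ_r = 1` and shows that
`f n s` depends only on the orbit of `s`.

*The commutant of the matrices `K g`.* By polynomiality in the entries of `g` and density of the
invertible matrices, a matrix `T` commuting with every `K g` commutes with each coefficient of
`K g` as a polynomial in these entries. The coefficients are the indicator matrices of the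
`S_m^r`-orbits on pairs of tuples, and they span the commutant of `S_m^r`. So `T` lies in the
bicommutant of the finite group `S_m^r`, which by a Maschke averaging argument is the span of the
group (`mem_span_range_of_commutes_centralizer`).

*Independence.* If `m ≤ n_k` for all `k`, the `m` diagonal multi-indices `(j, …, j)` are available,
and the monomial `∏_j x^{j⋯j} y_{t_1(j)⋯t_r(j)}` occurs in `f n s` exactly when `s` and `t` are
simultaneously conjugate (`mk_eq_mk_of_coeff_ne_zero`).
-/

noncomputable section

namespace TensorInvariants

variable {r : ℕ}

/-! ### Sums of unit vectors and diagonal substitutions -/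

/-- Two families with the same multiset of values differ by a permutation of the index set. -/
theorem exists_perm_of_sum_single_eq {ι α : Type*} [Fintype ι] (u v : ι → α)
    (h : ∑ j, Finsupp.single (u j) 1 = ∑ j, Finsupp.single (v j) (1 : ℕ)) :
    ∃ σ : Equiv.Perm ι, ∀ j, u (σ j) = v j := by
  classical
  have hcard : ∀ a, Nonempty ({j // v j = a} ≃ {j // u j = a}) := fun a => by
    rw [← Fintype.card_eq, Fintype.card_subtype, Fintype.card_subtype]
    have := DFunLike.congr_fun h a
    simpa [Finsupp.finsetSum_apply, Finsupp.single_apply] using this.symm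
  have φ := fun a => Classical.choice (hcard a)
  refine ⟨(Equiv.sigmaFiberEquiv v).symm.trans
    ((Equiv.sigmaCongrRight φ).trans (Equiv.sigmaFiberEquiv u)), fun j => ?_⟩
  exact (φ (v j) ⟨j, rfl⟩).2

/-- An exponent vector of degree `m` is the multiplicity function of an `m`-tuple. -/
theorem exists_sum_single_eq {α : Type*} {m : ℕ} (ν : α →₀ ℕ) (h : ν.degree = m) :
    ∃ B : Fin m → α, ∑ j, Finsupp.single (B j) 1 = ν := by
  classical
  induction m generalizing ν with
  | zero => exact ⟨Fin.elim0, by simpa using ((Finsupp.degree_eq_zero_iff ν).1 h).symm⟩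
  | succ m ih =>
    obtain ⟨a, ha⟩ : ∃ a, ν a ≠ 0 := by
      by_contra! h0
      simp [(Finsupp.ext h0 : ν = 0)] at h
    have hs : Finsupp.single a 1 ≤ ν := by
      rw [Finsupp.single_le_iff]; omega
    obtain ⟨ν', rfl⟩ := exists_add_of_le hs
    obtain ⟨B, hB⟩ := ih ν' (by simp at h; omega)
    exact ⟨Fin.cons a B, by simp [Fin.sum_univ_succ, hB]⟩

theorem coeff_aeval_smul_X {α : Type*} [Fintype α] (c : α → ℂ) (p : MvPolynomial α ℂ)
    (μ : α →₀ ℕ) :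
    MvPolynomial.coeff μ (MvPolynomial.aeval (fun i => c i • MvPolynomial.X (R := ℂ) i) p) =
      (∏ i, c i ^ μ i) * MvPolynomial.coeff μ p := by
  classical
  induction p using MvPolynomial.induction_on' with
  | monomial ν a =>
    have : MvPolynomial.aeval (fun i => c i • MvPolynomial.X (R := ℂ) i)
        (MvPolynomial.monomial ν a) = (∏ i, c i ^ ν i) • MvPolynomial.monomial ν a := by
      rw [MvPolynomial.aeval_monomial, MvPolynomial.monomial_eq, Finsupp.prod_fintype _ _ (by simp),
        Finsupp.prod_fintype _ _ (by simp)]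
      simp only [smul_pow, Finset.prod_smul, MvPolynomial.algebraMap_eq, mul_smul_comm]
    rw [this, MvPolynomial.coeff_smul, MvPolynomial.coeff_monomial]
    split_ifs with h
    · rw [h, smul_eq_mul]
    · simp
  | add p q hp hq => rw [map_add, MvPolynomial.coeff_add, hp, hq, MvPolynomial.coeff_add, mul_add]

/-! ### The bicommutant of a finite group of matrices -/

/-- The bicommutant of a finite group of matrices is its linear span `B`. An averaged projection `π`
onto `B` commutes with left multiplication by the group, so its blocks lie in the commutant. Hence
`π` commutes with left multiplication by `T`, and `T = T * π 1 = π T ∈ B`. -/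
theorem mem_span_range_of_commutes_centralizer {ι Γ : Type*} [Fintype ι] [DecidableEq ι] [Group Γ]
    [Fintype Γ] (P : Γ →* Matrix ι ι ℂ) (T : Matrix ι ι ℂ)
    (hT : ∀ N : Matrix ι ι ℂ, (∀ γ, Commute (P γ) N) → Commute T N) :
    T ∈ Submodule.span ℂ (Set.range P) := by
  set B := Submodule.span ℂ (Set.range P) with hB
  have hmem : ∀ γ, P γ ∈ B := fun γ => Submodule.subset_span ⟨γ, rfl⟩
  obtain ⟨p, hp⟩ := B.subtype.exists_leftInverse_of_injective (by simp)
  have hpB : ∀ b (hb : b ∈ B), (p b : Matrix ι ι ℂ) = b := fun b hb =>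
    congrArg Subtype.val (DFunLike.congr_fun hp ⟨b, hb⟩)
  have hmul : ∀ γ, ∀ b ∈ B, P γ * b ∈ B := fun γ b hb => by
    refine Submodule.span_induction ?_ ?_ ?_ ?_ hb
    · rintro _ ⟨δ, rfl⟩
      rw [← map_mul]; exact hmem _
    · simp
    · intro a b _ _ ha hb
      rw [mul_add]; exact add_mem ha hb
    · intro c a _ ha
      rw [mul_smul_comm]; exact B.smul_mem _ ha
  -- the average of `p` over `Γ`: a projection onto `B` that commutes with left multiplications
  let π : Matrix ι ι ℂ →ₗ[ℂ] Matrix ι ι ℂ := (Fintype.card Γ : ℂ)⁻¹ • ∑ γ : Γ,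
    LinearMap.mulLeft ℂ (P γ) ∘ₗ B.subtype ∘ₗ p ∘ₗ LinearMap.mulLeft ℂ (P γ⁻¹)
  have hπ : ∀ M, π M = (Fintype.card Γ : ℂ)⁻¹ • ∑ γ : Γ, P γ * (p (P γ⁻¹ * M) : Matrix ι ι ℂ) := by
    intro M; simp [π, LinearMap.sum_apply]
  have hπB : ∀ M, π M ∈ B := fun M => by
    rw [hπ]
    exact B.smul_mem _ (Submodule.sum_mem _ fun γ _ => hmul _ _ (p _).2)
  have hπ1 : π 1 = 1 := by
    rw [hπ]
    have : ∀ γ : Γ, P γ * (p (P γ⁻¹ * 1) : Matrix ι ι ℂ) = 1 := fun γ => by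
      rw [mul_one, hpB _ (hmem _), ← map_mul, mul_inv_cancel, map_one]
    simp only [this, Finset.sum_const, Finset.card_univ]
    rw [← Nat.cast_smul_eq_nsmul ℂ, smul_smul, inv_mul_cancel₀, one_smul]
    exact Nat.cast_ne_zero.2 Fintype.card_ne_zero
  have hπP : ∀ δ M, π (P δ * M) = P δ * π M := fun δ M => by
    rw [hπ, hπ, mul_smul_comm, Finset.mul_sum]
    congr 1
    refine Fintype.sum_equiv (Equiv.mulLeft δ⁻¹) _ _ fun γ => ?_
    simp only [Equiv.coe_mulLeft, ← mul_assoc, ← map_mul, mul_inv_rev, inv_inv, mul_inv_cancel,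
      one_mul]
  -- `N a b` records how `π` maps matrices supported in column `a` to column `b`
  let N : ι → ι → Matrix ι ι ℂ := fun a b => Matrix.of fun i j => π (Matrix.single j a 1) i b
  have hcol : ∀ (X : Matrix ι ι ℂ) (a j : ι),
      X * Matrix.single j a 1 = ∑ l, X l j • Matrix.single l a 1 := fun X a j => by
    ext i b
    by_cases hb : a = b
    · subst hb
      simp [Matrix.sum_apply, Matrix.single_apply]
    · simp [Matrix.sum_apply, hb, Matrix.mul_apply]
  have hN : ∀ X : Matrix ι ι ℂ, (∀ a b, Commute X (N a b)) ↔
      ∀ a j, π (X * Matrix.single j a 1) = X * π (Matrix.single j a 1) := fun X => by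
    have key : ∀ a b i j, (X * N a b) i j = (X * π (Matrix.single j a 1)) i b ∧
        (N a b * X) i j = π (X * Matrix.single j a 1) i b := fun a b i j => by
      constructor
      · simp [Matrix.mul_apply, N]
      · rw [hcol, map_sum, Matrix.sum_apply, Matrix.mul_apply]
        simp only [map_smul, Matrix.smul_apply, smul_eq_mul, N, Matrix.of_apply, mul_comm]
    constructor
    · intro h a j
      ext i b
      rw [← (key a b i j).1, ← (key a b i j).2, (h a b).eq]
    · intro h a b
      ext i j
      rw [(key a b i j).1, (key a b i j).2, h]
  have hTN := (hN T).1 fun a b => hT _ fun γ => (hN (P γ)).2 (fun a j => hπP _ _) a b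
  have hT1 : π T = T := by
    have h1 : (1 : Matrix ι ι ℂ) = ∑ j, Matrix.single j j 1 := by
      ext i j
      by_cases h : i = j
      · subst h; simp [Matrix.sum_apply, Matrix.single_apply]
      · simp [Matrix.sum_apply, Matrix.single_apply, h, ite_and]
    calc π T = π (T * 1) := by rw [mul_one]
      _ = T * π 1 := by
        rw [h1, Finset.mul_sum, map_sum, map_sum, Finset.mul_sum]
        exact Finset.sum_congr rfl fun j _ => hTN j j
      _ = T := by rw [hπ1, mul_one]
  rw [← hT1]; exact hπB T

/-! ### Place permutations -/

theorem permIdx_permIdx {n : Fin r → ℕ} {m : ℕ} (σ τ : Fin r → Equiv.Perm (Fin m))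
    (I : Fin m → Idx n) : permIdx σ (permIdx τ I) = permIdx (τ * σ) I := rfl

theorem permIdx_one {n : Fin r → ℕ} {m : ℕ} (I : Fin m → Idx n) : permIdx 1 I = I := rfl

theorem permIdx_injective {n : Fin r → ℕ} {m : ℕ} (σ : Fin r → Equiv.Perm (Fin m)) :
    Function.Injective (permIdx (n := n) σ) := fun I J h => by
  have := congrArg (permIdx σ⁻¹) h
  simpa only [permIdx_permIdx, mul_inv_cancel, permIdx_one] using this

theorem permIdx_eq_iff {n : Fin r → ℕ} {m : ℕ} (σ : Fin r → Equiv.Perm (Fin m))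
    (I J : Fin m → Idx n) : J = permIdx σ I ↔ permIdx σ⁻¹ J = I := by
  constructor
  · rintro rfl; simp only [permIdx_permIdx, mul_inv_cancel, permIdx_one]
  · rintro rfl; simp only [permIdx_permIdx, inv_mul_cancel, permIdx_one]

/-- The matrix of a place permutation: `σ_k` permutes the `m` places of the `k`-th tensor factor of
`V(n)^{⊗m}`. Since `σ ↦ permIdx σ` reverses products, the entry `1` is put at `(I, permIdx σ I)`
to obtain a homomorphism. -/
def placeMatrix (n : Fin r → ℕ) (m : ℕ) :
    (Fin r → Equiv.Perm (Fin m)) →* Matrix (Fin m → Idx n) (Fin m → Idx n) ℂ where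
  toFun σ := Matrix.of fun I J => if J = permIdx σ I then 1 else 0
  map_one' := by
    ext I J
    simp [permIdx_one, Matrix.one_apply, eq_comm]
  map_mul' σ τ := by
    ext I J
    simp only [Matrix.mul_apply, Matrix.of_apply, ite_mul, one_mul, zero_mul, Finset.sum_ite_eq',
      Finset.mem_univ, if_true, permIdx_permIdx]
    congr

theorem placeMatrix_apply (n : Fin r → ℕ) (m : ℕ) (σ : Fin r → Equiv.Perm (Fin m))
    (I J : Fin m → Idx n) :
    placeMatrix n m σ I J = if J = permIdx σ I then 1 else 0 := rfl

/-- Together with `commute_placeMatrix_of_apply_permIdx`: commuting with a place permutation means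
being invariant under the simultaneous permutation of row and column tuples. -/
theorem apply_permIdx_of_commute {n : Fin r → ℕ} {m : ℕ}
    {N : Matrix (Fin m → Idx n) (Fin m → Idx n) ℂ} {σ : Fin r → Equiv.Perm (Fin m)}
    (h : Commute (placeMatrix n m σ) N) (I J : Fin m → Idx n) :
    N (permIdx σ I) (permIdx σ J) = N I J := by
  have := congrFun (congrFun h.eq I) (permIdx σ J)
  simpa [Matrix.mul_apply, placeMatrix_apply, (permIdx_injective σ).eq_iff] using this

theorem commute_placeMatrix_of_apply_permIdx {n : Fin r → ℕ} {m : ℕ}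
    {N : Matrix (Fin m → Idx n) (Fin m → Idx n) ℂ} {σ : Fin r → Equiv.Perm (Fin m)}
    (h : ∀ I J, N (permIdx σ I) (permIdx σ J) = N I J) : Commute (placeMatrix n m σ) N := by
  ext I J
  obtain ⟨J, rfl⟩ : ∃ J', permIdx σ J' = J :=
    ⟨permIdx σ⁻¹ J, by rw [permIdx_permIdx, inv_mul_cancel, permIdx_one]⟩
  simpa [Matrix.mul_apply, placeMatrix_apply, (permIdx_injective σ).eq_iff] using h I J

/-! ### Tensor powers of matrices -/

/-- The matrix of `g₁^{⊗m} ⊗ ⋯ ⊗ g_r^{⊗m}` on `V(n)^{⊗m}`, in the basis indexed by `m`-tuples of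
multi-indices. -/
def tensorMatrix {R : Type*} [CommSemiring R] {n : Fin r → ℕ} (m : ℕ)
    (g : (k : Fin r) → Matrix (Fin (n k)) (Fin (n k)) R) :
    Matrix (Fin m → Idx n) (Fin m → Idx n) R :=
  Matrix.of fun I J => ∏ j, ∏ k, g k (I j k) (J j k)

theorem tensorMatrix_map {R S : Type*} [CommSemiring R] [CommSemiring S] {n : Fin r → ℕ} (m : ℕ)
    (φ : R →+* S) (g : (k : Fin r) → Matrix (Fin (n k)) (Fin (n k)) R) :
    (tensorMatrix m g).map φ = tensorMatrix m fun k => (g k).map φ := by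
  ext I J
  simp [tensorMatrix]

theorem tensorMatrix_permIdx {R : Type*} [CommSemiring R] {n : Fin r → ℕ} {m : ℕ}
    (g : (k : Fin r) → Matrix (Fin (n k)) (Fin (n k)) R) (σ : Fin r → Equiv.Perm (Fin m))
    (I J : Fin m → Idx n) :
    tensorMatrix m g (permIdx σ I) (permIdx σ J) = tensorMatrix m g I J := by
  simp only [tensorMatrix, Matrix.of_apply, permIdx]
  rw [Finset.prod_comm, Finset.prod_comm (s := (Finset.univ : Finset (Fin m)))]
  exact Finset.prod_congr rfl fun k _ =>
    Equiv.prod_comp (σ k) fun j => g k (I j k) (J j k)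

theorem tensorMatrix_one {R : Type*} [CommSemiring R] {n : Fin r → ℕ} (m : ℕ) :
    tensorMatrix m (1 : (k : Fin r) → Matrix (Fin (n k)) (Fin (n k)) R) = 1 := by
  ext I J
  simp only [tensorMatrix, Matrix.of_apply, Pi.one_apply, Matrix.one_apply, Fintype.prod_ite_zero,
    Finset.prod_const_one, funext_iff]

theorem tensorMatrix_mul {R : Type*} [CommSemiring R] {n : Fin r → ℕ} (m : ℕ)
    (g h : (k : Fin r) → Matrix (Fin (n k)) (Fin (n k)) R) :
    tensorMatrix m (g * h) = tensorMatrix m g * tensorMatrix m h := by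
  ext I J
  simp only [tensorMatrix, Matrix.of_apply, Pi.mul_apply, Matrix.mul_apply, Finset.prod_univ_sum,
    Fintype.piFinset_univ, Finset.prod_mul_distrib]

theorem tensorMatrix_inv_mul (n : Fin r → ℕ) (m : ℕ) (g : G n) :
    tensorMatrix m (fun k => ((g⁻¹) k : Matrix (Fin (n k)) (Fin (n k)) ℂ)) *
      tensorMatrix m (fun k => (g k : Matrix (Fin (n k)) (Fin (n k)) ℂ)) = 1 := by
  rw [← tensorMatrix_mul, ← tensorMatrix_one]
  congr 1
  funext k
  simp only [Pi.mul_apply, ← Units.val_mul, Pi.inv_apply, inv_mul_cancel, Units.val_one,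
    Pi.one_apply]

/-! ### The commutant of the tensor powers -/

/-- The exponent of the monomial `∏_j ∏_k X_{k, I_j(k), J_j(k)}`, which is the `(I, J)` entry of
the tensor power of the generic matrices. -/
def entryWeight {n : Fin r → ℕ} {m : ℕ} (I J : Fin m → Idx n) :
    (Σ k : Fin r, Fin (n k) × Fin (n k)) →₀ ℕ :=
  ∑ j, ∑ k, Finsupp.single ⟨k, I j k, J j k⟩ 1

theorem entryWeight_apply {n : Fin r → ℕ} {m : ℕ} (I J : Fin m → Idx n) (k : Fin r)
    (p : Fin (n k) × Fin (n k)) :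
    entryWeight I J ⟨k, p⟩ = ∑ j, Finsupp.single (I j k, J j k) 1 p := by
  simp only [entryWeight, Finsupp.finsetSum_apply]
  refine Finset.sum_congr rfl fun j _ => ?_
  rw [Finset.sum_eq_single k]
  · simp [Finsupp.single_apply]
  · intro k' _ hk
    rw [Finsupp.single_apply, if_neg]
    exact fun h => hk (congrArg Sigma.fst h)
  · simp

/-- The exponent `entryWeight I J` determines the pair `(I, J)` up to place permutations, so the
coefficients of the generic tensor power are the orbit indicators. -/
theorem exists_permIdx_of_entryWeight_eq {n : Fin r → ℕ} {m : ℕ} {I J I' J' : Fin m → Idx n}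
    (h : entryWeight I J = entryWeight I' J') :
    ∃ σ : Fin r → Equiv.Perm (Fin m), permIdx σ I = I' ∧ permIdx σ J = J' := by
  have key : ∀ k, ∃ σ : Equiv.Perm (Fin m), ∀ j, (I (σ j) k, J (σ j) k) = (I' j k, J' j k) := by
    intro k
    refine exists_perm_of_sum_single_eq (fun j => (I j k, J j k)) (fun j => (I' j k, J' j k))
      (Finsupp.ext fun p => ?_)
    have := DFunLike.congr_fun h ⟨k, p⟩
    rw [entryWeight_apply, entryWeight_apply] at this
    simpa only [Finsupp.finsetSum_apply] using this
  choose σ hσ using key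
  exact ⟨σ, funext fun j => funext fun k => congrArg Prod.fst (hσ k j),
    funext fun j => funext fun k => congrArg Prod.snd (hσ k j)⟩

/-- The generic `n_k × n_k` matrix, with the variables of the different factors `k` kept apart. -/
def genericMatrix (n : Fin r → ℕ) (k : Fin r) :
    Matrix (Fin (n k)) (Fin (n k)) (MvPolynomial (Σ k : Fin r, Fin (n k) × Fin (n k)) ℂ) :=
  Matrix.of fun a b => MvPolynomial.X ⟨k, a, b⟩

theorem tensorMatrix_genericMatrix (n : Fin r → ℕ) (m : ℕ) (I J : Fin m → Idx n) :
    tensorMatrix m (genericMatrix n) I J = MvPolynomial.monomial (entryWeight I J) 1 := by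
  simp [tensorMatrix, genericMatrix, entryWeight, MvPolynomial.X,
    MvPolynomial.monomial_sum_one]

/-- Density of the invertible matrices: the commutator of `T` with the generic tensor power, times
the product of the generic determinants, vanishes at every point. -/
theorem commute_tensorMatrix_genericMatrix {n : Fin r → ℕ} {m : ℕ}
    {T : Matrix (Fin m → Idx n) (Fin m → Idx n) ℂ}
    (hT : ∀ g : G n, Commute T (tensorMatrix m fun k => (g k : Matrix _ _ ℂ))) :
    Commute (T.map MvPolynomial.C) (tensorMatrix m (genericMatrix n)) := by
  set D := ∏ k, (genericMatrix n k).det with hD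
  have hev : ∀ v : (Σ k : Fin r, Fin (n k) × Fin (n k)) → ℂ, MvPolynomial.eval v D =
      ∏ k, (Matrix.of fun a b => v ⟨k, a, b⟩ : Matrix (Fin (n k)) (Fin (n k)) ℂ).det := by
    intro v
    rw [hD, map_prod]
    refine Finset.prod_congr rfl fun k _ => ?_
    rw [RingHom.map_det]
    congr 1
    ext a b
    simp [genericMatrix]
  -- the product of the determinants takes the value `1` at the identity matrices
  have hD0 : D ≠ 0 := fun h => by
    have := hev fun p => (1 : Matrix (Fin (n p.1)) (Fin (n p.1)) ℂ) p.2.1 p.2.2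
    have h1 : ∀ k, (Matrix.of fun a b => (1 : Matrix (Fin (n k)) (Fin (n k)) ℂ) a b) = 1 :=
      fun k => rfl
    simp [h, h1] at this
  refine sub_eq_zero.1 (Matrix.ext fun I J => ?_)
  refine (mul_eq_zero.1 ?_).resolve_right hD0
  refine MvPolynomial.funext fun v => ?_
  rw [map_mul, map_zero, mul_eq_zero, or_iff_not_imp_right, hev, Finset.prod_eq_zero_iff]
  intro hv
  push Not at hv
  let g : G n := fun k => Matrix.GeneralLinearGroup.mkOfDetNeZero _ (hv k (Finset.mem_univ k))
  have h1 : (tensorMatrix m (genericMatrix n)).map (MvPolynomial.eval v) =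
      tensorMatrix m fun k => (g k : Matrix _ _ ℂ) := by
    rw [tensorMatrix_map]
    congr 1
    funext k
    ext a b
    simp [genericMatrix, g, Matrix.GeneralLinearGroup.mkOfDetNeZero]
  have h2 : (T.map (MvPolynomial.C (σ := Σ k : Fin r, Fin (n k) × Fin (n k)))).map
      (MvPolynomial.eval v) = T := by
    ext I J; simp
  have h3 : ((T.map MvPolynomial.C * tensorMatrix m (genericMatrix n) -
      tensorMatrix m (genericMatrix n) * T.map MvPolynomial.C).map (MvPolynomial.eval v)) = 0 := by
    rw [Matrix.map_sub _ (map_sub _), Matrix.map_mul, Matrix.map_mul, h1, h2, (hT g).eq, sub_self]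
  exact congrFun (congrFun h3 I) J

/-- Polarization: the commutant of the place permutations is spanned by the coefficients of the
generic tensor power, so whatever commutes with all tensor powers commutes with this commutant. -/
theorem commute_of_commute_tensorMatrix {n : Fin r → ℕ} {m : ℕ}
    {T : Matrix (Fin m → Idx n) (Fin m → Idx n) ℂ}
    (hT : ∀ g : G n, Commute T (tensorMatrix m fun k => (g k : Matrix _ _ ℂ)))
    {N : Matrix (Fin m → Idx n) (Fin m → Idx n) ℂ}
    (hN : ∀ σ, Commute (placeMatrix n m σ) N) : Commute T N := by
  classical
  -- `E μ` is the coefficient at `μ` of the generic tensor power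
  let E : ((Σ k : Fin r, Fin (n k) × Fin (n k)) →₀ ℕ) →
      Matrix (Fin m → Idx n) (Fin m → Idx n) ℂ :=
    fun μ => Matrix.of fun I J => if entryWeight I J = μ then 1 else 0
  have hE : ∀ μ, Commute T (E μ) := fun μ => by
    ext I J
    have := congrArg (MvPolynomial.coeff μ)
      (congrFun (congrFun (commute_tensorMatrix_genericMatrix hT).eq I) J)
    simpa [Matrix.mul_apply, tensorMatrix_genericMatrix, MvPolynomial.coeff_sum,
      MvPolynomial.coeff_C_mul, mul_comm _ (MvPolynomial.C _), MvPolynomial.coeff_monomial, E]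
      using this
  let w : (Fin m → Idx n) × (Fin m → Idx n) → ((Σ k : Fin r, Fin (n k) × Fin (n k)) →₀ ℕ) :=
    fun p => entryWeight p.1 p.2
  have hf : Function.FactorsThrough (fun p : (Fin m → Idx n) × (Fin m → Idx n) => N p.1 p.2) w := by
    intro p p' h
    obtain ⟨σ, h1, h2⟩ := exists_permIdx_of_entryWeight_eq h
    simp only [← h1, ← h2, apply_permIdx_of_commute (hN σ)]
  -- `N` is constant on orbits of pairs, hence a combination of the indicators `E μ`
  have hsum : N = ∑ μ ∈ Finset.univ.image w,
      Function.extend w (fun p => N p.1 p.2) 0 μ • E μ := by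
    ext I J
    have h1 : Function.extend w (fun p => N p.1 p.2) 0 (entryWeight I J) = N I J :=
      hf.extend_apply 0 (I, J)
    have h2 : ∃ p, w p = entryWeight I J := ⟨(I, J), rfl⟩
    simp [Matrix.sum_apply, E, Finset.sum_ite_eq, h1, h2]
  rw [hsum]
  exact Commute.sum_right _ _ _ fun μ _ => (hE μ).smul_right _

/-- Schur–Weyl duality for `GL(n₁) × ⋯ × GL(n_r)`: the commutant of the tensor powers is spanned by
the place permutations. -/
theorem mem_span_range_placeMatrix {n : Fin r → ℕ} {m : ℕ}
    {T : Matrix (Fin m → Idx n) (Fin m → Idx n) ℂ}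
    (hT : ∀ g : G n, Commute T (tensorMatrix m fun k => (g k : Matrix _ _ ℂ))) :
    T ∈ Submodule.span ℂ (Set.range (placeMatrix n m)) :=
  mem_span_range_of_commutes_centralizer _ T fun _ hN => commute_of_commute_tensorMatrix hT hN

/-! ### Coordinates on `S(V(n) ⊕ V(n)^*)` and the action in coordinates -/

/-- The basis `e n I` of `V(n)`. -/
def basisV (n : Fin r → ℕ) : Module.Basis (Idx n) ℂ (V n) :=
  Basis.piTensorProduct fun k => Pi.basisFun ℂ (Fin (n k))

theorem basisV_apply (n : Fin r → ℕ) (I : Idx n) : basisV n I = e n I := by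
  simp [basisV, e]

theorem basisV_dualBasis_apply (n : Fin r → ℕ) (I : Idx n) :
    (basisV n).dualBasis I = eDual n I := by
  refine (basisV n).ext fun J => ?_
  rw [Module.Basis.dualBasis_apply_self, basisV_apply]
  simp only [eDual, e, PiTensorProduct.dualDistrib_apply, LinearMap.proj_apply, Pi.single_apply,
    Fintype.prod_ite_zero, Finset.prod_const_one, ← funext_iff]
  simp only [eq_comm]

/-- The identification of `S(V(n) ⊕ V(n)^*)` with a polynomial ring: `y n I` becomes the variable
`Sum.inl I` and `x n I` the variable `Sum.inr I`. -/
def toPoly (n : Fin r → ℕ) :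
    SymmetricAlgebra ℂ (W n) ≃ₐ[ℂ] MvPolynomial (Idx n ⊕ Idx n) ℂ :=
  SymmetricAlgebra.equivMvPolynomial ((basisV n).prod (basisV n).dualBasis)

theorem toPoly_y (n : Fin r → ℕ) (I : Idx n) :
    toPoly n (y n I) = MvPolynomial.X (Sum.inl I) := by
  have : ((basisV n).prod (basisV n).dualBasis) (Sum.inl I) = (e n I, 0) := by
    simp [basisV_apply]
  rw [y, ← this, toPoly, SymmetricAlgebra.equivMvPolynomial_ι_apply]

theorem toPoly_x (n : Fin r → ℕ) (I : Idx n) :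
    toPoly n (x n I) = MvPolynomial.X (Sum.inr I) := by
  have : ((basisV n).prod (basisV n).dualBasis) (Sum.inr I) = (0, eDual n I) := by
    simp [basisV_dualBasis_apply, -Module.Basis.coe_dualBasis]
  rw [x, ← this, toPoly, SymmetricAlgebra.equivMvPolynomial_ι_apply]

theorem repV_e (n : Fin r → ℕ) (g : G n) (B : Idx n) :
    repV n g (e n B) = ∑ A : Idx n, (∏ k, (g k : Matrix _ _ ℂ) (A k) (B k)) • e n A := by
  rw [← (basisV n).sum_repr (repV n g (e n B))]
  refine Finset.sum_congr rfl fun A _ => ?_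
  rw [basisV_apply]
  congr 1
  simp [repV, e, basisV]

theorem repV_dual_eDual (n : Fin r → ℕ) (g : G n) (A : Idx n) :
    (repV n).dual g (eDual n A) =
      ∑ B : Idx n, (∏ k, ((g⁻¹) k : Matrix _ _ ℂ) (A k) (B k)) • eDual n B := by
  refine (basisV n).ext fun C => ?_
  rw [basisV_apply, Representation.dual_apply, Module.Dual.transpose_apply, LinearMap.comp_apply,
    repV_e, map_sum, LinearMap.sum_apply]
  have h : ∀ I J, eDual n I (e n J) = if J = I then 1 else 0 := fun I J => by
    rw [← basisV_dualBasis_apply, ← basisV_apply, Module.Basis.dualBasis_apply_self]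
  simp [h]

theorem symRep_apply {Γ : Type*} [Group Γ] {M : Type*} [AddCommGroup M] [Module ℂ M]
    (ρ : Representation ℂ Γ M) (g : Γ) (a : SymmetricAlgebra ℂ M) :
    symRep ρ g a = SymmetricAlgebra.lift (SymmetricAlgebra.ι ℂ M ∘ₗ ρ g) a := rfl

theorem symRep_y (n : Fin r → ℕ) (g : G n) (B : Idx n) :
    symRep (repW n) g (y n B) =
      ∑ A : Idx n, (∏ k, (g k : Matrix _ _ ℂ) (A k) (B k)) • y n A := by
  have h : repW n g (e n B, 0) =
      LinearMap.inl ℂ _ (Module.Dual ℂ (V n)) (repV n g (e n B)) := by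
    simp [repW]
  rw [symRep_apply, y, SymmetricAlgebra.lift_ι_apply, LinearMap.comp_apply, h, repV_e]
  simp [y, map_sum, ← map_smul]

theorem symRep_x (n : Fin r → ℕ) (g : G n) (A : Idx n) :
    symRep (repW n) g (x n A) =
      ∑ B : Idx n, (∏ k, ((g⁻¹) k : Matrix _ _ ℂ) (A k) (B k)) • x n B := by
  have h : repW n g (0, eDual n A) =
      LinearMap.inr ℂ (V n) _ ((repV n).dual g (eDual n A)) := by
    simp [repW]
  rw [symRep_apply, x, SymmetricAlgebra.lift_ι_apply, LinearMap.comp_apply, h, repV_dual_eDual]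
  simp [x, map_sum, ← map_smul]

/-! ### From matrices to polynomials of bidegree `(m, m)` -/

/-- The monomial `y^B x^A = ∏_j y_{B_j} ∏_j x^{A_j}` of a pair of `m`-tuples of multi-indices. -/
def tupleMonomial (n : Fin r → ℕ) {m : ℕ} (B A : Fin m → Idx n) : SymmetricAlgebra ℂ (W n) :=
  (∏ j, y n (B j)) * ∏ j, x n (A j)

theorem symRep_tupleMonomial (n : Fin r → ℕ) {m : ℕ} (g : G n) (B A : Fin m → Idx n) :
    symRep (repW n) g (tupleMonomial n B A) = ∑ B', ∑ A',
      (tensorMatrix m (fun k => (g k : Matrix _ _ ℂ)) B' B *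
        tensorMatrix m (fun k => ((g⁻¹) k : Matrix _ _ ℂ)) A A') • tupleMonomial n B' A' := by
  have hy := symRep_y n g
  have hx := symRep_x n g
  simp only [symRep_apply] at hy hx ⊢
  simp only [tupleMonomial, map_mul, map_prod, hy, hx, Finset.prod_univ_sum, Fintype.piFinset_univ,
    Finset.sum_mul_sum, Finset.prod_smul, smul_mul_smul_comm]
  rfl

/-- The map `M ↦ ∑ M_{BA} y^B x^A` from `End(V(n)^{⊗m}) = V(n)^{⊗m} ⊗ (V(n)^*)^{⊗m}` to
`S^m(V(n)) ⊗ S^m(V(n)^*)`, viewed inside `S(V(n) ⊕ V(n)^*)`. -/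
def restitution (n : Fin r → ℕ) (m : ℕ) :
    Matrix (Fin m → Idx n) (Fin m → Idx n) ℂ →ₗ[ℂ] SymmetricAlgebra ℂ (W n) :=
  ∑ B, ∑ A, (Matrix.entryLinearMap ℂ ℂ B A).smulRight (tupleMonomial n B A)

theorem restitution_apply (n : Fin r → ℕ) (m : ℕ) (M : Matrix (Fin m → Idx n) (Fin m → Idx n) ℂ) :
    restitution n m M = ∑ B, ∑ A, M B A • tupleMonomial n B A := by
  simp [restitution, LinearMap.sum_apply]

theorem symRep_restitution (n : Fin r → ℕ) (m : ℕ) (g : G n)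
    (M : Matrix (Fin m → Idx n) (Fin m → Idx n) ℂ) :
    symRep (repW n) g (restitution n m M) =
      restitution n m (tensorMatrix m (fun k => (g k : Matrix _ _ ℂ)) * M *
        tensorMatrix m (fun k => ((g⁻¹) k : Matrix _ _ ℂ))) := by
  simp only [restitution_apply, map_sum, map_smul, symRep_tupleMonomial, Finset.smul_sum, smul_smul,
    Matrix.mul_apply, Finset.sum_smul, Finset.sum_mul]
  rw [Finset.sum_comm, Finset.sum_comm_cycle]
  refine Finset.sum_congr rfl fun B' _ => ?_
  rw [Finset.sum_comm_cycle]
  refine Finset.sum_congr rfl fun A' _ => Finset.sum_congr rfl fun A _ =>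
    Finset.sum_congr rfl fun B _ => ?_
  rw [← mul_assoc, mul_comm (M B A)]

/-- The exponent of the monomial `y^B x^A` in the variables of `toPoly`. -/
def pairWeight {α : Type*} {m : ℕ} (B A : Fin m → α) : α ⊕ α →₀ ℕ :=
  ∑ j, Finsupp.single (Sum.inl (B j)) 1 + ∑ j, Finsupp.single (Sum.inr (A j)) 1

theorem toPoly_tupleMonomial (n : Fin r → ℕ) {m : ℕ} (B A : Fin m → Idx n) :
    toPoly n (tupleMonomial n B A) = MvPolynomial.monomial (pairWeight B A) 1 := by
  simp only [tupleMonomial, map_mul, map_prod, toPoly_x, toPoly_y, pairWeight, MvPolynomial.X,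
    ← MvPolynomial.monomial_sum_one]
  rw [MvPolynomial.monomial_mul, one_mul]

theorem coeff_toPoly_tupleMonomial (n : Fin r → ℕ) {m : ℕ} (B A : Fin m → Idx n)
    (μ : Idx n ⊕ Idx n →₀ ℕ) :
    MvPolynomial.coeff μ (toPoly n (tupleMonomial n B A)) =
      if pairWeight B A = μ then 1 else 0 := by
  rw [toPoly_tupleMonomial, MvPolynomial.coeff_monomial]

theorem exists_perm_of_pairWeight_eq {α : Type*} {m : ℕ} {B A B' A' : Fin m → α}
    (h : pairWeight B A = pairWeight B' A') :
    ∃ σ τ : Equiv.Perm (Fin m), B' = B ∘ σ ∧ A' = A ∘ τ := by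
  classical
  have hB : ∑ j, Finsupp.single (B j) 1 = ∑ j, Finsupp.single (B' j) (1 : ℕ) := by
    ext a
    simpa [pairWeight, Finsupp.finsetSum_apply, Finsupp.single_apply] using
      DFunLike.congr_fun h (Sum.inl a)
  have hA : ∑ j, Finsupp.single (A j) 1 = ∑ j, Finsupp.single (A' j) (1 : ℕ) := by
    ext a
    simpa [pairWeight, Finsupp.finsetSum_apply, Finsupp.single_apply] using
      DFunLike.congr_fun h (Sum.inr a)
  obtain ⟨σ, hσ⟩ := exists_perm_of_sum_single_eq B B' hB
  obtain ⟨τ, hτ⟩ := exists_perm_of_sum_single_eq A A' hA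
  exact ⟨σ, τ, funext fun j => (hσ j).symm, funext fun j => (hτ j).symm⟩

theorem tupleMonomial_comp_perm (n : Fin r → ℕ) {m : ℕ} (B A : Fin m → Idx n)
    (σ τ : Equiv.Perm (Fin m)) :
    tupleMonomial n (B ∘ σ) (A ∘ τ) = tupleMonomial n B A := by
  simp only [tupleMonomial, Function.comp_apply]
  rw [Equiv.prod_comp σ fun j => y n (B j), Equiv.prod_comp τ fun j => x n (A j)]

/-- Invariance under independent permutations of the row tuple and of the column tuple. Only the
`m` multi-indices are permuted, each as a whole. -/
def IsBisymmetric {α : Type*} {m : ℕ} (M : Matrix (Fin m → α) (Fin m → α) ℂ) : Prop :=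
  ∀ (σ τ : Equiv.Perm (Fin m)) (B A : Fin m → α), M (B ∘ σ) (A ∘ τ) = M B A

/-- On bisymmetric matrices the restitution is injective: the coefficient of `y^B x^A` is `M_{BA}`
times the number of pairs of tuples with the same monomial. -/
theorem IsBisymmetric.eq_of_restitution_eq {n : Fin r → ℕ} {m : ℕ}
    {M N : Matrix (Fin m → Idx n) (Fin m → Idx n) ℂ} (hM : IsBisymmetric M)
    (hN : IsBisymmetric N) (h : restitution n m M = restitution n m N) : M = N := by
  ext B A
  have key : ∀ L : Matrix (Fin m → Idx n) (Fin m → Idx n) ℂ, IsBisymmetric L →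
      MvPolynomial.coeff (pairWeight B A) (toPoly n (restitution n m L)) =
        (∑ B' : Fin m → Idx n, ∑ A' : Fin m → Idx n,
          if pairWeight B' A' = pairWeight B A then 1 else 0 : ℕ) * L B A := by
    intro L hL
    simp only [restitution_apply, map_sum, map_smul, MvPolynomial.coeff_sum,
      MvPolynomial.coeff_smul, coeff_toPoly_tupleMonomial, Nat.cast_sum, Finset.sum_mul]
    refine Finset.sum_congr rfl fun B' _ => Finset.sum_congr rfl fun A' _ => ?_
    split_ifs with hw
    · obtain ⟨σ, τ, rfl, rfl⟩ := exists_perm_of_pairWeight_eq hw.symm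
      simp [hL σ τ B A]
    · simp
  have h0 : (∑ B' : Fin m → Idx n, ∑ A' : Fin m → Idx n,
      if pairWeight B' A' = pairWeight B A then 1 else 0 : ℕ) ≠ 0 := by
    intro h0
    simp only [Finset.sum_eq_zero_iff, Finset.mem_univ, true_imp_iff] at h0
    simpa using h0 B A
  have := key M hM
  rw [h, key N hN] at this
  exact (mul_left_cancel₀ (Nat.cast_ne_zero.2 h0) this).symm

/-- The average over `S_m × S_m` has the same image, because the factors of `y^B x^A` commute. -/
theorem exists_isBisymmetric_restitution_eq (n : Fin r → ℕ) {m : ℕ}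
    (M : Matrix (Fin m → Idx n) (Fin m → Idx n) ℂ) :
    ∃ N, IsBisymmetric N ∧ restitution n m N = restitution n m M := by
  let c : ℂ := (Fintype.card (Equiv.Perm (Fin m) × Equiv.Perm (Fin m)) : ℂ)
  have hc : c ≠ 0 := Nat.cast_ne_zero.2 Fintype.card_ne_zero
  let S : Equiv.Perm (Fin m) × Equiv.Perm (Fin m) → Matrix (Fin m → Idx n) (Fin m → Idx n) ℂ :=
    fun p => M.submatrix (fun B => B ∘ p.1) (fun A => A ∘ p.2)
  refine ⟨c⁻¹ • ∑ p, S p, fun σ τ B A => ?_, ?_⟩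
  · simp only [Matrix.smul_apply, Matrix.sum_apply, S, Matrix.submatrix_apply]
    congr 1
    exact Fintype.sum_equiv (Equiv.mulLeft (σ, τ)) _ _ fun p => rfl
  · have hS : ∀ p, restitution n m (S p) = restitution n m M := fun p => by
      simp only [restitution_apply, S, Matrix.submatrix_apply]
      refine Fintype.sum_equiv (p.1.symm.arrowCongr (Equiv.refl _)) _ _ fun B =>
        Fintype.sum_equiv (p.2.symm.arrowCongr (Equiv.refl _)) _ _ fun A => ?_
      conv_lhs => rw [← tupleMonomial_comp_perm n B A p.1 p.2]
      rfl
    rw [map_smul, map_sum, Finset.sum_congr rfl fun p _ => hS p, Finset.sum_const,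
      Finset.card_univ, ← Nat.cast_smul_eq_nsmul ℂ, smul_smul, inv_mul_cancel₀ hc, one_smul]

theorem IsBisymmetric.mul_mul {n : Fin r → ℕ} {m : ℕ}
    {M : Matrix (Fin m → Idx n) (Fin m → Idx n) ℂ} (hM : IsBisymmetric M)
    (g h : (k : Fin r) → Matrix (Fin (n k)) (Fin (n k)) ℂ) :
    IsBisymmetric (tensorMatrix m g * M * tensorMatrix m h) := by
  intro σ τ B A
  simp only [Matrix.mul_apply]
  refine (Fintype.sum_equiv (τ.symm.arrowCongr (Equiv.refl _)) _ _ fun A' => ?_).symm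
  have hτ := tensorMatrix_permIdx h (fun _ => τ) A' A
  refine congrArg₂ _ (Fintype.sum_equiv (σ.symm.arrowCongr (Equiv.refl _)) _ _ fun B' => ?_) hτ.symm
  exact congrArg₂ _ (tensorMatrix_permIdx g (fun _ => σ) B B').symm (hM σ τ B' A').symm

theorem symRep_restitution_of_commute {n : Fin r → ℕ} {m : ℕ} {g : G n}
    {M : Matrix (Fin m → Idx n) (Fin m → Idx n) ℂ}
    (h : Commute M (tensorMatrix m fun k => (g k : Matrix _ _ ℂ))) :
    symRep (repW n) g (restitution n m M) = restitution n m M := by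
  have h1 := mul_eq_one_comm.1 (tensorMatrix_inv_mul n m g)
  rw [symRep_restitution, ← h.eq, mul_assoc, h1, mul_one]

/-- A bisymmetric matrix with invariant image is determined by this image, hence commutes with the
tensor powers, and Schur–Weyl duality applies to it. -/
theorem mem_span_restitution_placeMatrix {n : Fin r → ℕ} {m : ℕ} {a : SymmetricAlgebra ℂ (W n)}
    (ha : a ∈ LinearMap.range (restitution n m)) (hG : a ∈ (symRep (repW n)).invariants) :
    a ∈ Submodule.span ℂ (Set.range fun σ => restitution n m (placeMatrix n m σ)) := by
  obtain ⟨M, rfl⟩ := ha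
  obtain ⟨N, hN, hNM⟩ := exists_isBisymmetric_restitution_eq n M
  rw [← hNM] at hG ⊢
  have hcomm : ∀ g : G n, Commute N (tensorMatrix m fun k => (g k : Matrix _ _ ℂ)) := by
    intro g
    have h := hG g
    rw [symRep_restitution] at h
    have h' := (hN.mul_mul _ _).eq_of_restitution_eq hN h
    have h2 := congrArg (· * tensorMatrix m fun k => (g k : Matrix (Fin (n k)) (Fin (n k)) ℂ)) h'
    simp only [mul_assoc, tensorMatrix_inv_mul, mul_one] at h2
    exact h2.symm
  have := Submodule.mem_map_of_mem (f := restitution n m) (mem_span_range_placeMatrix hcomm)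
  rwa [Submodule.map_span, ← Set.range_comp] at this

/-! ### The bidegree of an invariant -/

theorem isHomogeneous_toPoly {n : Fin r → ℕ} {d : ℕ} {a : SymmetricAlgebra ℂ (W n)}
    (ha : a ∈ symPower (W n) d) : (toPoly n a).IsHomogeneous d := by
  have h1 : (LinearMap.range (SymmetricAlgebra.ι ℂ (W n))).map (toPoly n).toAlgHom.toLinearMap ≤
      MvPolynomial.homogeneousSubmodule (Idx n ⊕ Idx n) ℂ 1 := by
    rintro _ ⟨_, ⟨w, rfl⟩, rfl⟩
    rw [← ((basisV n).prod (basisV n).dualBasis).sum_repr w]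
    simp only [map_sum, map_smul]
    refine Submodule.sum_mem _ fun i _ => Submodule.smul_mem _ _ ?_
    have := SymmetricAlgebra.equivMvPolynomial_ι_apply ((basisV n).prod (basisV n).dualBasis) i
    exact (congrArg (· ∈ MvPolynomial.homogeneousSubmodule (Idx n ⊕ Idx n) ℂ 1) this).mpr
      (MvPolynomial.isHomogeneous_X ℂ i)
  have h2 := Submodule.mem_map_of_mem (f := (toPoly n).toAlgHom.toLinearMap) ha
  rw [symPower, Submodule.map_pow] at h2
  have h3 := pow_le_pow_left' h1 d h2
  rwa [MvPolynomial.homogeneousSubmodule_one_pow] at h3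

/-- The element `(2, 1, …, 1)` of `G(n)`. It acts on `V(n)` as the scalar `2` and on
`V(n)^*` as the scalar `1/2`. -/
def scaleFirst {q : ℕ} (n : Fin (q + 1) → ℕ) : G n := fun k =>
  if k = 0 then Units.mk0 (2 : ℂ) two_ne_zero • (1 : GL (Fin (n k)) ℂ) else 1

theorem prod_smul_one_apply {n : Fin r → ℕ} (c : Fin r → ℂ) (A B : Idx n) :
    ∏ k, (c k • (1 : Matrix (Fin (n k)) (Fin (n k)) ℂ)) (A k) (B k) =
      if A = B then ∏ k, c k else 0 := by
  simp only [Matrix.smul_apply, Matrix.one_apply, smul_eq_mul, mul_ite, mul_one, mul_zero,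
    Fintype.prod_ite_zero, ← funext_iff]

theorem coe_scaleFirst {q : ℕ} (n : Fin (q + 1) → ℕ) (k : Fin (q + 1)) :
    (scaleFirst n k : Matrix (Fin (n k)) (Fin (n k)) ℂ) =
      (if k = 0 then (2 : ℂ) else 1) • (1 : Matrix (Fin (n k)) (Fin (n k)) ℂ) := by
  unfold scaleFirst
  split_ifs
  · ext; simp [Units.smul_def]
  · simp

theorem coe_scaleFirst_inv {q : ℕ} (n : Fin (q + 1) → ℕ) (k : Fin (q + 1)) :
    ((scaleFirst n)⁻¹ k : Matrix (Fin (n k)) (Fin (n k)) ℂ) =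
      (if k = 0 then (2⁻¹ : ℂ) else 1) • (1 : Matrix (Fin (n k)) (Fin (n k)) ℂ) := by
  refine Units.inv_eq_of_mul_eq_one_right ?_
  rw [coe_scaleFirst]
  split_ifs <;> simp [smul_smul]

theorem symRep_scaleFirst_y {q : ℕ} (n : Fin (q + 1) → ℕ) (I : Idx n) :
    symRep (repW n) (scaleFirst n) (y n I) = (2 : ℂ) • y n I := by
  rw [symRep_y]
  simp only [coe_scaleFirst, prod_smul_one_apply]
  simp

theorem symRep_scaleFirst_x {q : ℕ} (n : Fin (q + 1) → ℕ) (I : Idx n) :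
    symRep (repW n) (scaleFirst n) (x n I) = (2⁻¹ : ℂ) • x n I := by
  rw [symRep_x]
  simp only [coe_scaleFirst_inv, prod_smul_one_apply]
  simp

theorem toPoly_symRep_scaleFirst {q : ℕ} (n : Fin (q + 1) → ℕ) (a : SymmetricAlgebra ℂ (W n)) :
    toPoly n (symRep (repW n) (scaleFirst n) a) =
      MvPolynomial.aeval (fun i => Sum.elim (fun _ : Idx n => (2 : ℂ)) (fun _ : Idx n => 2⁻¹) i •
        MvPolynomial.X (R := ℂ) i) (toPoly n a) := by
  obtain ⟨p, rfl⟩ := (toPoly n).symm.surjective a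
  rw [AlgEquiv.apply_symm_apply]
  have : ((toPoly n).toAlgHom.comp (SymmetricAlgebra.lift (SymmetricAlgebra.ι ℂ (W n) ∘ₗ
      repW n (scaleFirst n)))).comp (toPoly n).symm.toAlgHom =
      MvPolynomial.aeval (fun i => Sum.elim (fun _ : Idx n => (2 : ℂ)) (fun _ : Idx n => 2⁻¹) i •
        MvPolynomial.X (R := ℂ) i) := by
    refine MvPolynomial.algHom_ext fun i => ?_
    rw [MvPolynomial.aeval_X]
    rcases i with I | I
    · have h := symRep_scaleFirst_y n I
      rw [symRep_apply] at h
      have e : (toPoly n).symm (MvPolynomial.X (Sum.inl I)) = y n I := by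
        rw [← toPoly_y, AlgEquiv.symm_apply_apply]
      simp [e, h, toPoly_y]
    · have h := symRep_scaleFirst_x n I
      rw [symRep_apply] at h
      have e : (toPoly n).symm (MvPolynomial.X (Sum.inr I)) = x n I := by
        rw [← toPoly_x, AlgEquiv.symm_apply_apply]
      simp [e, h, toPoly_x]
  exact DFunLike.congr_fun this p

theorem exists_pairWeight_eq {α : Type*} [Fintype α] {m : ℕ} {μ : α ⊕ α →₀ ℕ}
    (hl : ∑ a, μ (Sum.inl a) = m) (hr : ∑ a, μ (Sum.inr a) = m) :
    ∃ B A : Fin m → α, pairWeight B A = μ := by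
  classical
  obtain ⟨B, hB⟩ := exists_sum_single_eq (m := m) (μ.comapDomain Sum.inl Sum.inl_injective.injOn)
    (by rw [Finsupp.degree_eq_sum]; simpa using hl)
  obtain ⟨A, hA⟩ := exists_sum_single_eq (m := m) (μ.comapDomain Sum.inr Sum.inr_injective.injOn)
    (by rw [Finsupp.degree_eq_sum]; simpa using hr)
  refine ⟨B, A, Finsupp.ext fun i => ?_⟩
  rcases i with a | a
  · simpa [pairWeight, Finsupp.finsetSum_apply, Finsupp.single_apply] using DFunLike.congr_fun hB a
  · simpa [pairWeight, Finsupp.finsetSum_apply, Finsupp.single_apply] using DFunLike.congr_fun hA a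

/-- An invariant of degree `2m` has degree `m` in the `y_I` and in the `x^I`, by invariance under
`scaleFirst n`, so it is a combination of the monomials `y^B x^A`. -/
theorem mem_range_restitution {q m : ℕ} {n : Fin (q + 1) → ℕ} {a : SymmetricAlgebra ℂ (W n)}
    (ha : a ∈ invariants n (2 * m)) : a ∈ LinearMap.range (restitution n m) := by
  obtain ⟨hd, hG⟩ := ha
  have hhom := isHomogeneous_toPoly hd
  have hscale := toPoly_symRep_scaleFirst n a
  rw [hG (scaleFirst n)] at hscale
  rw [← (toPoly n).symm_apply_apply a, (toPoly n a).as_sum, map_sum]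
  refine Submodule.sum_mem _ fun μ hμ => ?_
  have hμ0 := MvPolynomial.mem_support_iff.1 hμ
  have hdeg : μ.degree = 2 * m := by
    rw [Finsupp.degree_eq_weight_one]; exact hhom hμ0
  rw [Finsupp.degree_eq_sum, Fintype.sum_sum_type] at hdeg
  have hc := congrArg (MvPolynomial.coeff μ) hscale
  rw [coeff_aeval_smul_X] at hc
  -- the coefficient at `μ` is nonzero and is scaled by `2 ^ a * 2⁻¹ ^ b`, with `a`, `b` the
  -- degrees of `μ` in the two sets of variables
  have h1 := (mul_eq_right₀ hμ0).1 hc.symm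
  simp only [Fintype.prod_sum_type, Sum.elim_inl, Sum.elim_inr, Finset.prod_pow_eq_pow_sum]
    at h1
  rw [inv_pow, mul_inv_eq_one₀ (pow_ne_zero _ two_ne_zero)] at h1
  have h2 : ∑ I, μ (Sum.inl I) = ∑ I, μ (Sum.inr I) := by
    refine Nat.pow_right_injective (le_refl 2) ?_
    exact_mod_cast h1
  obtain ⟨B, A, hBA⟩ := exists_pairWeight_eq (μ := μ) (m := m) (by omega) (by omega)
  refine ⟨Matrix.single B A (MvPolynomial.coeff μ (toPoly n a)), ?_⟩
  rw [AlgEquiv.eq_symm_apply, restitution_apply, Finset.sum_eq_single B, Finset.sum_eq_single A]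
  · rw [Matrix.single_apply_same, map_smul, toPoly_tupleMonomial, hBA, MvPolynomial.smul_monomial,
      smul_eq_mul, mul_one]
  · intro A' _ h; rw [Matrix.single_apply_of_col_ne _ _ h.symm, zero_smul]
  · simp
  · intro B' _ h
    exact Finset.sum_eq_zero fun A' _ => by
      rw [Matrix.single_apply_of_row_ne h.symm, zero_smul]
  · simp

/-! ### The polynomials attached to tuples of permutations -/

/-- The inverse occurs because rows of the matrix go with `y` and columns with `x`: the nonzero
entries are those at `(B, A)` with `B = permIdx σ A`. -/
theorem fullPoly_eq_restitution (n : Fin r → ℕ) {m : ℕ} (σ : Fin r → Equiv.Perm (Fin m)) :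
    fullPoly n σ = restitution n m (placeMatrix n m σ⁻¹) := by
  rw [fullPoly, restitution_apply, Finset.sum_comm]
  refine Finset.sum_congr rfl fun A _ => ?_
  simp only [placeMatrix_apply, permIdx_eq_iff, inv_inv, ite_smul, one_smul, zero_smul,
    Finset.sum_ite_eq, Finset.mem_univ, if_true, tupleMonomial, Finset.prod_mul_distrib]
  exact mul_comm _ _

theorem fullPoly_mem_symPower (n : Fin r → ℕ) {m : ℕ} (σ : Fin r → Equiv.Perm (Fin m)) :
    fullPoly n σ ∈ symPower (W n) (2 * m) := by
  refine Submodule.sum_mem _ fun I _ => ?_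
  have key : ∀ s : Finset (Fin m), ∏ j ∈ s, (x n (I j) * y n (permIdx σ I j)) ∈
      symPower (W n) (2 * s.card) := by
    intro s
    induction s using Finset.cons_induction with
    | empty => simp [symPower]
    | cons j s hj ih =>
      rw [Finset.prod_cons, Finset.card_cons, mul_add, mul_one, add_comm, symPower, pow_add,
        pow_two]
      exact Submodule.mul_mem_mul (Submodule.mul_mem_mul ⟨_, rfl⟩ ⟨_, rfl⟩) ih
  simpa using key Finset.univ

theorem fullPoly_mem_invariants (n : Fin r → ℕ) {m : ℕ} (σ : Fin r → Equiv.Perm (Fin m)) :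
    fullPoly n σ ∈ invariants n (2 * m) := by
  refine ⟨fullPoly_mem_symPower n σ, fun g => ?_⟩
  rw [fullPoly_eq_restitution]
  exact symRep_restitution_of_commute
    (commute_placeMatrix_of_apply_permIdx fun I J => tensorMatrix_permIdx _ _ I J)

/-- Right multiplication by a diagonal element permutes the factors `y` of each product. -/
theorem fullPoly_mul_right (n : Fin r → ℕ) {m : ℕ} (σ : Fin r → Equiv.Perm (Fin m))
    (ρ : Equiv.Perm (Fin m)) : fullPoly n (fun k => σ k * ρ) = fullPoly n σ := by
  simp only [fullPoly, Finset.prod_mul_distrib]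
  refine Finset.sum_congr rfl fun I _ => congrArg _ ?_
  exact Equiv.prod_comp ρ fun j => y n (permIdx σ I j)

/-- Left multiplication by a diagonal element renames the indices of summation. -/
theorem fullPoly_mul_left (n : Fin r → ℕ) {m : ℕ} (σ : Fin r → Equiv.Perm (Fin m))
    (γ : Equiv.Perm (Fin m)) : fullPoly n (fun k => γ * σ k) = fullPoly n σ := by
  simp only [fullPoly, Finset.prod_mul_distrib]
  refine Fintype.sum_equiv (γ.symm.arrowCongr (Equiv.refl _)) _ _ fun I => ?_
  exact congrArg (· * _) (Equiv.prod_comp γ fun j => x n (I j)).symm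

theorem f_conj {q m : ℕ} (n : Fin (q + 1) → ℕ) (s : Fin q → Equiv.Perm (Fin m))
    (γ : Equiv.Perm (Fin m)) : f n (fun k => γ * s k * γ⁻¹) = f n s := by
  rw [f, f, ← fullPoly_mul_left n (Fin.snoc s 1) γ,
    ← fullPoly_mul_right n (fun k => γ * Fin.snoc (α := fun _ => Equiv.Perm (Fin m)) s 1 k) γ⁻¹]
  congr 1
  funext k
  refine Fin.lastCases ?_ (fun k => ?_) k <;> simp

theorem fullPoly_eq_f {q m : ℕ} (n : Fin (q + 1) → ℕ) (σ : Fin (q + 1) → Equiv.Perm (Fin m)) :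
    fullPoly n σ = f n fun k => σ k.castSucc * (σ (Fin.last q))⁻¹ := by
  rw [f, ← fullPoly_mul_right n σ (σ (Fin.last q))⁻¹]
  congr 1
  funext k
  refine Fin.lastCases ?_ (fun k => ?_) k <;> simp

theorem span_f_eq_invariants {q m : ℕ} (n : Fin (q + 1) → ℕ)
    (rep : ConjOrbits q m → (Fin q → Equiv.Perm (Fin m)))
    (hrep : ∀ o, (Quotient.mk'' (rep o) : ConjOrbits q m) = o) :
    Submodule.span ℂ (Set.range fun o => f n (rep o)) = invariants n (2 * m) := by
  apply le_antisymm
  · rw [Submodule.span_le]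
    rintro _ ⟨o, rfl⟩
    exact fullPoly_mem_invariants n _
  · intro a ha
    refine Submodule.span_le.2 ?_ (mem_span_restitution_placeMatrix (mem_range_restitution ha) ha.2)
    rintro _ ⟨σ, rfl⟩
    have h := fullPoly_eq_restitution n σ⁻¹
    rw [inv_inv] at h
    simp only [← h]
    rw [fullPoly_eq_f]
    set s : Fin q → Equiv.Perm (Fin m) := _
    obtain ⟨γ, hγ⟩ := (conjOrbits_mk_eq_iff _ _).1 (hrep (Quotient.mk'' s))
    refine Submodule.subset_span ⟨Quotient.mk'' s, ?_⟩
    simp only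
    rw [← funext hγ, f_conj]

/-! ### Linear independence -/

/-- The diagonal multi-index `(j, …, j)`. -/
def diagIdx {n : Fin r → ℕ} {m : ℕ} (h : ∀ k, m ≤ n k) (j : Fin m) : Idx n :=
  fun k => Fin.castLE (h k) j

theorem coeff_toPoly_fullPoly (n : Fin r → ℕ) {m : ℕ} (σ : Fin r → Equiv.Perm (Fin m))
    (μ : Idx n ⊕ Idx n →₀ ℕ) :
    MvPolynomial.coeff μ (toPoly n (fullPoly n σ)) =
      ((Finset.univ.filter fun I : Fin m → Idx n => pairWeight (permIdx σ I) I = μ).card : ℂ) := by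
  have : ∀ I : Fin m → Idx n, ∏ j, (x n (I j) * y n (permIdx σ I j)) =
      tupleMonomial n (permIdx σ I) I := fun I => by rw [Finset.prod_mul_distrib, mul_comm,
        tupleMonomial]
  simp only [fullPoly, this, map_sum, MvPolynomial.coeff_sum, coeff_toPoly_tupleMonomial,
    Finset.sum_boole]

theorem coeff_toPoly_f_self_ne_zero {q m : ℕ} {n : Fin (q + 1) → ℕ} (h : ∀ k, m ≤ n k)
    (s : Fin q → Equiv.Perm (Fin m)) :
    MvPolynomial.coeff (pairWeight (permIdx (Fin.snoc s 1) (diagIdx h)) (diagIdx h))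
      (toPoly n (f n s)) ≠ 0 := by
  rw [f, coeff_toPoly_fullPoly, Nat.cast_ne_zero, Finset.card_ne_zero]
  exact ⟨diagIdx h, by simp⟩

/-- With pairwise distinct diagonal indices, a term of `f n s` equal to the diagonal monomial of `t`
yields `γ, ρ` with `γ s_k = t_k ρ` for all `k`; the last factor gives `γ = ρ`, so `γ` conjugates
`s` to `t`. -/
theorem mk_eq_mk_of_coeff_ne_zero {q m : ℕ} {n : Fin (q + 1) → ℕ} (h : ∀ k, m ≤ n k)
    {s t : Fin q → Equiv.Perm (Fin m)}
    (hst : MvPolynomial.coeff (pairWeight (permIdx (Fin.snoc t 1) (diagIdx h)) (diagIdx h))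
      (toPoly n (f n s)) ≠ 0) :
    (Quotient.mk'' t : ConjOrbits q m) = Quotient.mk'' s := by
  rw [f, coeff_toPoly_fullPoly, Nat.cast_ne_zero, Finset.card_ne_zero] at hst
  obtain ⟨I, hI⟩ := hst
  obtain ⟨ρ, γ, h1, rfl⟩ := exists_perm_of_pairWeight_eq (Finset.mem_filter.1 hI).2.symm
  have key : ∀ k : Fin (q + 1), γ * (Fin.snoc (α := fun _ => Equiv.Perm (Fin m)) s 1 k) =
      Fin.snoc (α := fun _ => Equiv.Perm (Fin m)) t 1 k * ρ := fun k => by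
    ext j
    simpa [permIdx, diagIdx] using congrArg Fin.val (congrFun (congrFun h1 j) k)
  -- `s` and `t` both have last permutation `1`, whence `γ = ρ`
  have hlast := key (Fin.last q)
  simp only [Fin.snoc_last, mul_one, one_mul] at hlast
  refine (conjOrbits_mk_eq_iff _ _).2 ⟨γ, fun k => ?_⟩
  have hk := key k.castSucc
  simp only [Fin.snoc_castSucc] at hk
  rw [hk, hlast, mul_inv_cancel_right]

theorem linearIndependent_f {q m : ℕ} {n : Fin (q + 1) → ℕ} (h : ∀ k, m ≤ n k)
    (rep : ConjOrbits q m → (Fin q → Equiv.Perm (Fin m)))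
    (hrep : ∀ o, (Quotient.mk'' (rep o) : ConjOrbits q m) = o) :
    LinearIndependent ℂ fun o => f n (rep o) := by
  classical
  have : Fintype (ConjOrbits q m) := Fintype.ofFinite _
  rw [Fintype.linearIndependent_iff]
  intro c hc o
  have h0 := congrArg (fun a => MvPolynomial.coeff
    (pairWeight (permIdx (Fin.snoc (rep o) 1) (diagIdx h)) (diagIdx h)) (toPoly n a)) hc
  simp only [map_sum, map_smul, map_zero, MvPolynomial.coeff_sum, MvPolynomial.coeff_smul,
    MvPolynomial.coeff_zero] at h0
  rw [Finset.sum_eq_single o] at h0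
  · exact (smul_eq_zero.1 h0).resolve_right (coeff_toPoly_f_self_ne_zero h _)
  · intro o' _ ho
    rw [smul_eq_zero, or_iff_not_imp_right]
    intro hne
    have := mk_eq_mk_of_coeff_ne_zero h hne
    rw [hrep, hrep] at this
    exact absurd this.symm ho
  · simp

end TensorInvariants

end

theorem mainTheorem2 {q m : ℕ} (n : Fin (q + 1) → ℕ) (hn : ∀ k, 1 ≤ n k)
    (rep : TensorInvariants.ConjOrbits q m → (Fin q → Equiv.Perm (Fin m)))
    (hrep : ∀ o, (Quotient.mk'' (rep o) : TensorInvariants.ConjOrbits q m) = o) :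
    Submodule.span ℂ (Set.range fun o => TensorInvariants.f n (rep o)) =
        TensorInvariants.invariants n (2 * m) ∧
      ((∀ k, m ≤ n k) →
        ∃ b : Module.Basis (TensorInvariants.ConjOrbits q m) ℂ
            (TensorInvariants.invariants n (2 * m)),
          ∀ o, (b o : SymmetricAlgebra ℂ (TensorInvariants.W n)) =
            TensorInvariants.f n (rep o)) := by
  have hspan := TensorInvariants.span_f_eq_invariants n rep hrep
  refine ⟨hspan, fun h => ?_⟩
  refine ⟨(Module.Basis.span (TensorInvariants.linearIndependent_f h rep hrep)).map
    (LinearEquiv.ofEq _ _ hspan), fun o => ?_⟩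
  rw [Module.Basis.map_apply, LinearEquiv.coe_ofEq_apply, Module.Basis.span_apply]
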